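/- Let $d, n, k$ be integers with $d\ge 1$, $n \ge 1$ and $0 \le k \le n$. Let $\xi^n$ be a state (a positive semidefinite operator of trace one) on $(\mathbb{C}^d)^{\otimes n}$ which is Bose-symmetric, i.e. $\pi\,\xi^n = \xi^n$ for every permutation $\pi \in S_n$, where $\pi$ acts on $(\mathbb{C}^d)^{\otimes n}$ by permuting the tensor factors. Let $\xi^k := \mathrm{tr}_{n-k}(\xi^n)$ be the reduced state on $(\mathbb{C}^d)^{\otimes k}$ obtained by tracing out $n-k$ of the tensor factors. For a Hermitian operator $A$ write $\|A\| := \tfrac12 \mathrm{tr}|A|$. Then $\xi^k$ is $\varepsilon$-close to the set $\mathcal{P}_{(k)}(\mathbb{C}^d)$ of mixtures of pure product states, with $\varepsilon := 2\,\frac{dk}{n}$; that is, there exists a Borel probability measure $m$ on the unit vectors $\varphi$ of $\mathbb{C}^d$ such that $$\Bigl\| \xi^k - \int \bigl(|\varphi\rangle\langle\varphi|\bigr)^{\otimes k}\, dm(\varphi) \Bigr\| \;\le\; 2\,\frac{dk}{n}.$$ -/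

import Mathlib

open scoped Matrix ComplexOrder MatrixOrder

noncomputable section

namespace BoseDeFinetti

/-- Operators on `(ℂ^d)^{⊗n}`, as matrices in the product basis
`|x₁⟩ ⊗ ⋯ ⊗ |xₙ⟩`, which is indexed by the words `x : Fin n → Fin d`. -/
abbrev Op (d n : ℕ) : Type := Matrix (Fin n → Fin d) (Fin n → Fin d) ℂ

/-- A (mixed) state on `(ℂ^d)^{⊗n}`: a positive semidefinite operator of trace one. -/
def IsState {d n : ℕ} (ξ : Op d n) : Prop :=
  ξ.PosSemidef ∧ ξ.trace = 1

/-- The unitary that permutes the `n` tensor factors: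
`π |y₁, …, yₙ⟩ = |y_{π⁻¹(1)}, …, y_{π⁻¹(n)}⟩`. -/
def permOp (d : ℕ) {n : ℕ} (π : Equiv.Perm (Fin n)) : Op d n :=
  Matrix.of fun x y => if x = y ∘ π.symm then 1 else 0

/-- Bose symmetry: `π ξ = ξ` for every permutation `π` of the `n` tensor factors. -/
def IsBoseSymmetric {d n : ℕ} (ξ : Op d n) : Prop :=
  ∀ π : Equiv.Perm (Fin n), permOp d π * ξ = ξ

/-- The word of length `n` consisting of `x` (length `k`) followed by `z` (length `n - k`). -/
def joinWord {d n k : ℕ} (hk : k ≤ n) (x : Fin k → Fin d) (z : Fin (n - k) → Fin d) :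
    Fin n → Fin d :=
  Fin.append x z ∘ Fin.cast (Nat.add_sub_of_le hk).symm

/-- The partial trace over the last `n - k` of the `n` tensor factors. -/
def partialTrace {d n k : ℕ} (hk : k ≤ n) (ξ : Op d n) : Op d k :=
  Matrix.of fun x y => ∑ z : Fin (n - k) → Fin d, ξ (joinWord hk x z) (joinWord hk y z)

/-- The unit vectors of `ℂ^d`. -/
abbrev UnitVector (d : ℕ) : Type := Metric.sphere (0 : EuclideanSpace ℂ (Fin d)) 1

/-- The coordinates of the product vector `φ^{⊗k}` in the product basis. -/
def tensorPower {d : ℕ} (k : ℕ) (φ : UnitVector d) : (Fin k → Fin d) → ℂ :=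
  fun x => ∏ i, φ.1 (x i)

/-- The pure product state `|φ⟩⟨φ|^{⊗k}`. -/
def pureProduct {d : ℕ} (k : ℕ) (φ : UnitVector d) : Op d k :=
  Matrix.vecMulVec (tensorPower k φ) (star (tensorPower k φ))

/-- The set of all `∫ |φ⟩⟨φ|^{⊗k} dm(φ)`, with `m` a Borel probability measure on the unit
vectors of `ℂ^d`. The integral is taken entrywise; its integrand is bounded and continuous. -/
def pureProductMixtures (d k : ℕ) : Set (Op d k) :=
  {σ | ∃ m : MeasureTheory.Measure (UnitVector d), MeasureTheory.IsProbabilityMeasure m ∧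
    σ = Matrix.of fun x y => ∫ φ, pureProduct k φ x y ∂m}

/-- The trace norm with the normalisation `‖A‖ = ½ tr |A|`, where `|A| = √(A* A)`. -/
def traceNorm {d k : ℕ} (A : Op d k) : ℝ :=
  (1 / 2) * (CFC.abs A).trace.re

/-- `ξ` is `ε`-close to the set `S` in trace distance. -/
def IsCloseTo {d k : ℕ} (ε : ℝ) (ξ : Op d k) (S : Set (Op d k)) : Prop :=
  ∃ σ ∈ S, traceNorm (ξ - σ) ≤ ε

end BoseDeFinetti

end

section

open MeasureTheory Set

/-! Write `d = e + 1` and `D_n = (n+e).choose e`, the dimension of the symmetric subspace, and let μ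
be the uniform probability measure on unit vectors. Reweighting μ by `W(φ) = D_n ⟨φ^{⊗n}|ξ|φ^{⊗n}⟩`
gives a probability measure, whose mixture is called σ. The crux is the operator inequality `σ ≥ p
ξ^k` with `p = D_{n-k}/D_n` (`exists_mixture_ge`). Both sides being states up to the factor p, it
forces `‖ξ^k - σ‖ ≤ 1 - p` (`traceNorm_sub_le_one_sub`), and `1 - p ≤ ek/n` is a binomial estimate
(`one_sub_mul_choose_le`).

Bose symmetry factors ξ through symmetric tensors ψ (`IsState.exists_symmetric_factor`), so the
inequality can be checked on each ψ. There it is a completed square on the sphere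
(`contraction_le_integral`), evaluated by Schur orthogonality: `D_m ∫ |φ⟩⟨φ|^{⊗m} dμ` is the
symmetric projector. That is derived from explicit sphere moments, themselves read off from Gaussian
integrals. -/

/-! ### Gaussian integrals and moments of the sphere -/

theorem integral_pow_mul_exp_neg_sq (N : ℕ) :
    ∫ r in Ioi (0 : ℝ), r ^ (2 * N + 1) * Real.exp (-r ^ 2) = (N.factorial : ℝ) / 2 := by
  have h := integral_rpow_mul_exp_neg_rpow (p := 2) (q := 2 * N + 1) (by norm_num)
    (by have : (0 : ℝ) ≤ N := N.cast_nonneg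
        linarith)
  rw [show ((2 * N + 1 + 1 : ℝ) / 2) = N + 1 by ring, Real.Gamma_nat_eq_factorial] at h
  rw [div_eq_inv_mul, ← one_div, ← h]
  refine setIntegral_congr_fun measurableSet_Ioi fun r _ => ?_
  rw [← Real.rpow_natCast r 2, ← Real.rpow_natCast]
  push_cast
  rfl

theorem integral_exp_int_mul_I (j : ℤ) :
    ∫ θ in Ioo (-Real.pi) Real.pi, Complex.exp (j * θ * Complex.I) =
      if j = 0 then 2 * (Real.pi : ℂ) else 0 := by
  rw [← integral_Ioc_eq_integral_Ioo,
    ← intervalIntegral.integral_of_le (by linarith [Real.pi_pos])]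
  split_ifs with hj
  · simp [hj]; ring
  · have hc : (j * Complex.I : ℂ) ≠ 0 := by simp [hj]
    simp only [mul_right_comm _ _ Complex.I]
    rw [integral_exp_mul_complex hc, div_eq_zero_iff, sub_eq_zero, Complex.exp_eq_exp_iff_exists_int]
    left
    exact ⟨j, by push_cast; ring⟩

theorem integral_complex_gaussian_moment (a b : ℕ) :
    ∫ z : ℂ, z ^ a * star z ^ b * (Real.exp (-‖z‖ ^ 2) : ℂ) =
      if a = b then (Real.pi * a.factorial : ℂ) else 0 := by
  rw [← Complex.integral_comp_polarCoord_symm]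
  have key : ∀ p ∈ polarCoord.target, p.1 • ((Complex.polarCoord.symm p) ^ a *
      star (Complex.polarCoord.symm p) ^ b *
        (Real.exp (-‖Complex.polarCoord.symm p‖ ^ 2) : ℂ)) =
      ((p.1 ^ (a + b + 1) * Real.exp (-p.1 ^ 2) : ℝ) : ℂ) *
        Complex.exp (((a : ℤ) - (b : ℤ) : ℤ) * p.2 * Complex.I) := by
    intro p hp
    have hr : (0 : ℝ) < p.1 := hp.1
    have h1 : Complex.polarCoord.symm p = p.1 * Complex.exp (p.2 * Complex.I) := by
      rw [Complex.polarCoord_symm_apply, Complex.exp_mul_I]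
      simp
    have h2 : ‖Complex.polarCoord.symm p‖ = p.1 := by
      rw [Complex.norm_polarCoord_symm, abs_of_pos hr]
    have h3 : star (Complex.exp (p.2 * Complex.I)) = Complex.exp (-(p.2 * Complex.I)) := by
      rw [Complex.star_def, ← Complex.exp_conj]
      simp
    rw [h2, h1, star_mul', h3, Complex.star_def, Complex.conj_ofReal, mul_pow, mul_pow,
      ← Complex.exp_nat_mul, ← Complex.exp_nat_mul]
    have h4 : Complex.exp (((a : ℤ) - (b : ℤ) : ℤ) * p.2 * Complex.I) =
        Complex.exp (a * (p.2 * Complex.I)) * Complex.exp (b * -(p.2 * Complex.I)) := by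
      rw [← Complex.exp_add]
      congr 1
      push_cast
      ring
    rw [h4, Complex.real_smul]
    push_cast
    ring
  rw [setIntegral_congr_fun polarCoord.open_target.measurableSet key]
  rw [polarCoord_target, Measure.volume_eq_prod,
    setIntegral_prod_mul (fun r : ℝ => ((r ^ (a + b + 1) * Real.exp (-r ^ 2) : ℝ) : ℂ))
      (fun θ : ℝ => Complex.exp (((a : ℤ) - (b : ℤ) : ℤ) * θ * Complex.I)),
    integral_exp_int_mul_I]
  by_cases hab : a = b
  · subst hab
    rw [integral_complex_ofReal, ← two_mul, integral_pow_mul_exp_neg_sq]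
    simp
    ring
  · have : (a : ℤ) - b ≠ 0 := by omega
    rw [if_neg this, if_neg hab, mul_zero]

/-- Polar coordinates separate the variables, as homogeneity pulls the radius out of `f`. Sphere
moments thus become quotients of Gaussian moments by radial integrals. -/
theorem integral_homogeneous_mul_gaussian {E : Type*} [NormedAddCommGroup E] [NormedSpace ℝ E]
    [MeasurableSpace E] [BorelSpace E] [FiniteDimensional ℝ E] [Nontrivial E]
    (μ : Measure E) [μ.IsAddHaarMeasure] (f : E → ℂ) (N : ℕ)
    (hf : ∀ (r : ℝ) (x : E), f (r • x) = (r : ℂ) ^ N * f x) :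
    ∫ x, f x * (Real.exp (-‖x‖ ^ 2) : ℂ) ∂μ =
      (∫ u : Metric.sphere (0 : E) 1, f u ∂μ.toSphere) *
        (∫ r in Ioi (0 : ℝ), r ^ (Module.finrank ℝ E - 1 + N) * Real.exp (-r ^ 2) : ℝ) := by
  set n := Module.finrank ℝ E - 1
  calc
    _ = ∫ x : ({(0)}ᶜ : Set E), f x * (Real.exp (-‖x.1‖ ^ 2) : ℂ) ∂(μ.comap (↑)) := by
      rw [integral_subtype_comap (measurableSet_singleton _).compl
        fun x => f x * (Real.exp (-‖x‖ ^ 2) : ℂ), restrict_compl_singleton]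
    _ = ∫ p : Metric.sphere (0 : E) 1 × Ioi (0 : ℝ),
          f p.1 * ((p.2.1 ^ N * Real.exp (-p.2.1 ^ 2) : ℝ) : ℂ)
          ∂μ.toSphere.prod (.volumeIoiPow n) := by
      rw [← μ.measurePreserving_homeomorphUnitSphereProd.integral_comp
        (Homeomorph.measurableEmbedding _)]
      refine integral_congr_ae (Filter.Eventually.of_forall fun x => ?_)
      have hx : x.1 = ‖x.1‖ • ((homeomorphUnitSphereProd E x).1 : E) := by
        have h0 : ‖x.1‖ ≠ 0 := norm_ne_zero_iff.2 x.2
        simp [smul_smul, h0]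
      have h2 : (homeomorphUnitSphereProd E x).2.1 = ‖x.1‖ := by simp
      simp only [h2]
      conv_lhs => rw [hx]
      rw [hf, ← hx]
      push_cast
      ring
    _ = (∫ u : Metric.sphere (0 : E) 1, f u ∂μ.toSphere) *
        ∫ r : Ioi (0 : ℝ), ((r.1 ^ N * Real.exp (-r.1 ^ 2) : ℝ) : ℂ) ∂(.volumeIoiPow n) :=
      integral_prod_mul (fun u : Metric.sphere (0 : E) 1 => f u)
        (fun r : Ioi (0 : ℝ) => ((r.1 ^ N * Real.exp (-r.1 ^ 2) : ℝ) : ℂ))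
    _ = _ := by
      congr 1
      rw [integral_complex_ofReal]
      congr 1
      simp only [Measure.volumeIoiPow, ENNReal.ofReal]
      rw [integral_withDensity_eq_integral_smul,
        integral_subtype_comap measurableSet_Ioi
          fun a : ℝ => Real.toNNReal (a ^ n) • (a ^ N * Real.exp (-a ^ 2)),
        setIntegral_congr_fun measurableSet_Ioi fun x hx => ?_]
      · rw [NNReal.smul_def, Real.coe_toNNReal _ (pow_nonneg hx.out.le _), smul_eq_mul, pow_add,
          mul_assoc]
      · exact (measurable_subtype_coe.pow_const _).real_toNNReal

/-- If the letter counts agree, the permutations in question form a coset of the stabilizer of `w`;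
otherwise there are none. The product over letters matches the one-variable Gaussian moments factor
by factor. -/
theorem card_perm_comp_eq {α ι : Type*} [Fintype α] [DecidableEq α] [Fintype ι] [DecidableEq ι]
    (w w' : α → ι) :
    (Fintype.card {π : Equiv.Perm α // w ∘ π = w'}) =
      ∏ a, if Fintype.card {i // w i = a} = Fintype.card {i // w' i = a} then
        (Fintype.card {i // w i = a}).factorial else 0 := by
  by_cases h : ∀ a, Fintype.card {i // w i = a} = Fintype.card {i // w' i = a}
  · have e : ∀ a, {i // w' i = a} ≃ {i // w i = a} := fun a =>
      Fintype.equivOfCardEq (h a).symm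
    let σ : Equiv.Perm α := (Equiv.sigmaFiberEquiv w').symm.trans
      ((Equiv.sigmaCongrRight e).trans (Equiv.sigmaFiberEquiv w))
    have hσ : w ∘ σ = w' := by
      funext i
      exact (e (w' i) ⟨i, rfl⟩).2
    simp only [h, if_true]
    simp only [← h]
    rw [← DomMulAct.stabilizer_card]
    refine Fintype.card_congr ((Equiv.mulRight σ⁻¹).subtypeEquiv fun π => ?_)
    simp only [Equiv.coe_mulRight, Equiv.Perm.coe_mul, ← Function.comp_assoc]
    constructor
    · intro hπ
      rw [hπ, ← hσ, Function.comp_assoc, ← Equiv.Perm.coe_mul, mul_inv_cancel]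
      rfl
    · intro hπ
      rw [← hσ]
      nth_rw 2 [← hπ]
      rw [Function.comp_assoc, ← Equiv.Perm.coe_mul, inv_mul_cancel]
      rfl
  · have : IsEmpty {π : Equiv.Perm α // w ∘ π = w'} := by
      refine ⟨fun π => h fun a => ?_⟩
      refine (Fintype.card_congr (π.1.subtypeEquiv fun i => ?_)).symm
      exact Eq.congr (congrFun π.2 i).symm rfl
    obtain ⟨a, ha⟩ := not_forall.1 h
    rw [Fintype.card_eq_zero, Finset.prod_eq_zero (Finset.mem_univ a)]
    rw [if_neg ha]

theorem prod_comp_eq_prod_pow {α ι M : Type*} [Fintype α] [Fintype ι] [DecidableEq ι]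
    [CommMonoid M] (w : α → ι) (z : ι → M) :
    ∏ i, z (w i) = ∏ a, z a ^ Fintype.card {i // w i = a} := by
  rw [Finset.prod_comp, Finset.prod_subset (Finset.subset_univ _)]
  · simp [Fintype.card_subtype]
  · intro a _ ha
    have : Finset.univ.filter (fun i => w i = a) = ∅ := by
      ext i
      simpa using fun h => ha (by simp [← h])
    rw [this]
    simp

theorem integral_gaussian_words {d m : ℕ} (w w' : Fin m → Fin d) :
    ∫ z : Fin d → ℂ, (∏ i, z (w i)) * star (∏ i, z (w' i)) *
        (Real.exp (-∑ a, ‖z a‖ ^ 2) : ℂ) =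
      Real.pi ^ d * Fintype.card {π : Equiv.Perm (Fin m) // w ∘ π = w'} := by
  have h : ∀ z : Fin d → ℂ, (∏ i, z (w i)) * star (∏ i, z (w' i)) *
        (Real.exp (-∑ a, ‖z a‖ ^ 2) : ℂ) =
      ∏ a, (z a ^ Fintype.card {i // w i = a} * star (z a) ^ Fintype.card {i // w' i = a} *
        (Real.exp (-‖z a‖ ^ 2) : ℂ)) := by
    intro z
    rw [prod_comp_eq_prod_pow w, prod_comp_eq_prod_pow w', ← Finset.sum_neg_distrib,
      Real.exp_sum, Finset.prod_mul_distrib, Finset.prod_mul_distrib]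
    simp only [Complex.star_def, map_prod, map_pow, Complex.ofReal_prod]
  simp only [h]
  rw [integral_fintype_prod_volume_eq_prod (f := fun a (z : ℂ) =>
    z ^ Fintype.card {i // w i = a} * star z ^ Fintype.card {i // w' i = a} *
        (Real.exp (-‖z‖ ^ 2) : ℂ))]
  simp only [integral_complex_gaussian_moment]
  rw [card_perm_comp_eq]
  push_cast
  have hpi : (Real.pi : ℂ) ^ d = ∏ _a : Fin d, (Real.pi : ℂ) := by simp
  rw [hpi, ← Finset.prod_mul_distrib]
  refine Finset.prod_congr rfl fun a _ => ?_
  split_ifs <;> simp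

theorem exists_sphere_measure (e : ℕ) :
    ∃ μ : Measure (BoseDeFinetti.UnitVector (e + 1)), IsProbabilityMeasure μ ∧
      ∀ (m : ℕ) (w w' : Fin m → Fin (e + 1)),
        ∫ φ, BoseDeFinetti.tensorPower m φ w * star (BoseDeFinetti.tensorPower m φ w') ∂μ =
          Fintype.card {π : Equiv.Perm (Fin m) // w ∘ π = w'} *
            ((e.factorial : ℂ) / (m + e).factorial) := by
  let L := (PiLp.continuousLinearEquiv 2 ℝ (fun _ : Fin (e + 1) => ℂ)).symm
  let ν : Measure (EuclideanSpace ℂ (Fin (e + 1))) := volume.map L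
  have hν : ν.IsAddHaarMeasure := L.isAddHaarMeasure_map volume
  have hdim : Module.finrank ℝ (EuclideanSpace ℂ (Fin (e + 1))) = 2 * (e + 1) := by
    rw [← LinearEquiv.finrank_eq L.toLinearEquiv, Module.finrank_pi_fintype]
    simp [Complex.finrank_real_complex, mul_comm]
  have : FiniteDimensional ℝ (EuclideanSpace ℂ (Fin (e + 1))) :=
    L.toLinearEquiv.finiteDimensional
  have : Nontrivial (EuclideanSpace ℂ (Fin (e + 1))) := L.symm.toEquiv.nontrivial
  have moment : ∀ (m : ℕ) (w w' : Fin m → Fin (e + 1)),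
      ∫ φ, BoseDeFinetti.tensorPower m φ w * star (BoseDeFinetti.tensorPower m φ w')
        ∂ν.toSphere = Fintype.card {π : Equiv.Perm (Fin m) // w ∘ π = w'} *
            (2 * Real.pi ^ (e + 1) / (m + e).factorial) := by
    intro m w w'
    have h := integral_homogeneous_mul_gaussian ν
      (fun z => (∏ i, z (w i)) * star (∏ i, z (w' i))) (2 * m) (by
        intro r x
        simp only [PiLp.smul_apply, Complex.real_smul, Finset.prod_mul_distrib,
          Finset.prod_const, Finset.card_univ, Fintype.card_fin, Complex.star_def, map_mul,
          map_pow, Complex.conj_ofReal]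
        ring)
    rw [hdim, show 2 * (e + 1) - 1 + 2 * m = 2 * (m + e) + 1 by omega,
      integral_pow_mul_exp_neg_sq] at h
    have h2 : ∫ x, (∏ i, x (w i)) * star (∏ i, x (w' i)) * (Real.exp (-‖x‖ ^ 2) : ℂ) ∂ν =
        Real.pi ^ (e + 1) * Fintype.card {π : Equiv.Perm (Fin m) // w ∘ π = w'} := by
      rw [← integral_gaussian_words]
      have := L.toHomeomorph.measurableEmbedding.integral_map (μ := volume)
        (fun x => (∏ i, x (w i)) * star (∏ i, x (w' i)) * (Real.exp (-‖x‖ ^ 2) : ℂ))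
      refine this.trans ?_
      refine integral_congr_ae (Filter.Eventually.of_forall fun z => ?_)
      simp only [EuclideanSpace.norm_sq_eq]
      rfl
    rw [h2] at h
    have hf : ((m + e).factorial : ℂ) ≠ 0 := by exact_mod_cast (m + e).factorial_ne_zero
    have h3 : (∫ φ, BoseDeFinetti.tensorPower m φ w *
        star (BoseDeFinetti.tensorPower m φ w') ∂ν.toSphere) * ((m + e).factorial / 2 : ℂ) =
      Real.pi ^ (e + 1) * Fintype.card {π : Equiv.Perm (Fin m) // w ∘ π = w'} := by
      rw [h]
      push_cast
      rfl
    field_simp at h3 ⊢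
    linear_combination h3
  -- The normalising constant is the moment of degree 0.
  have hmass : ν.toSphere.real univ = 2 * Real.pi ^ (e + 1) / e.factorial := by
    have h := moment 0 Fin.elim0 Fin.elim0
    simp only [BoseDeFinetti.tensorPower, Finset.univ_eq_empty, Finset.prod_empty, star_one,
      mul_one, integral_const, zero_add] at h
    have hc : Fintype.card {π : Equiv.Perm (Fin 0) // (Fin.elim0 : Fin 0 → Fin (e + 1)) ∘ π =
        Fin.elim0} = 1 := by
      rw [Fintype.card_eq_one_iff]
      exact ⟨⟨1, Subsingleton.elim _ _⟩, fun _ => Subsingleton.elim _ _⟩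
    rw [hc, Complex.real_smul] at h
    have h' : ((ν.toSphere.real univ : ℝ) : ℂ) =
      ((2 * Real.pi ^ (e + 1) / e.factorial : ℝ) : ℂ) := by
      push_cast
      simpa using h
    exact_mod_cast h'
  refine ⟨(ν.toSphere univ)⁻¹ • ν.toSphere, ⟨?_⟩, fun m w w' => ?_⟩
  · rw [Measure.smul_apply, smul_eq_mul, ENNReal.inv_mul_cancel]
    · exact Measure.measure_univ_ne_zero.2 ν.toSphere_ne_zero
    · exact measure_ne_top _ _
  · rw [integral_smul_measure, moment, ENNReal.toReal_inv, ← Measure.real, hmass,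
      Complex.real_smul]
    have hf : (e.factorial : ℂ) ≠ 0 := by exact_mod_cast e.factorial_ne_zero
    have hp : (Real.pi : ℂ) ≠ 0 := by exact_mod_cast Real.pi_ne_zero
    push_cast
    field_simp

/-! ### Homogeneous polynomials on the sphere -/

namespace BoseDeFinetti

/-- The homogeneous polynomial `∑ u(w) φ(w₁) ⋯ φ(wₘ)` with coefficient tensor `u`. -/
noncomputable def wordPoly {d m : ℕ} (u : (Fin m → Fin d) → ℂ) (φ : UnitVector d) : ℂ :=
  ∑ w, tensorPower m φ w * u w

/-- The coefficient tensor is invariant under permutations of the letters. -/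
def IsSymmTensor {d m : ℕ} (v : (Fin m → Fin d) → ℂ) : Prop :=
  ∀ (π : Equiv.Perm (Fin m)) (w : Fin m → Fin d), v (w ∘ π) = v w

/-- The sphere moments of the uniform probability measure on the unit vectors of `ℂ^(e+1)`. -/
def HasUniformMoments {e : ℕ} (μ : Measure (UnitVector (e + 1))) : Prop :=
  ∀ (m : ℕ) (w w' : Fin m → Fin (e + 1)),
    ∫ φ, tensorPower m φ w * star (tensorPower m φ w') ∂μ =
      Fintype.card {π : Equiv.Perm (Fin m) // w ∘ π = w'} *
        ((e.factorial : ℂ) / (m + e).factorial)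

theorem continuous_tensorPower {d m : ℕ} (w : Fin m → Fin d) :
    Continuous fun φ : UnitVector d => tensorPower m φ w := by
  unfold tensorPower
  fun_prop

theorem continuous_wordPoly {d m : ℕ} (u : (Fin m → Fin d) → ℂ) :
    Continuous (wordPoly u) :=
  continuous_finsetSum _ fun w _ => (continuous_tensorPower w).mul continuous_const

theorem integrable_of_continuous {d : ℕ} {F : Type*} [NormedAddCommGroup F]
    (μ : Measure (UnitVector d)) [IsProbabilityMeasure μ] {f : UnitVector d → F}
    (hf : Continuous f) : Integrable f μ :=
  hf.integrable_of_hasCompactSupport (HasCompactSupport.of_compactSpace f)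

theorem IsSymmTensor.star {d m : ℕ} {v : (Fin m → Fin d) → ℂ} (hv : IsSymmTensor v) :
    IsSymmTensor (star v) := fun π w => congrArg Star.star (hv π w)

/-- Schur orthogonality: the moments average over permutations, and the average disappears against a
symmetric tensor. Symmetry of one factor suffices, which is needed later for a product tensor `u`.
-/
theorem integral_wordPoly_mul_star {e m : ℕ} {μ : Measure (UnitVector (e + 1))}
    [IsProbabilityMeasure μ] (hμ : HasUniformMoments μ) (u v : (Fin m → Fin (e + 1)) → ℂ)
    (hv : IsSymmTensor v) :
    ∫ φ, wordPoly u φ * star (wordPoly v φ) ∂μ =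
      ((m + e).choose e : ℂ)⁻¹ * ∑ w, u w * star (v w) := by
  have hint : ∀ w w' : Fin m → Fin (e + 1), Integrable
      (fun φ => tensorPower m φ w * star (tensorPower m φ w') * (u w * star (v w'))) μ :=
    fun w w' => integrable_of_continuous μ
      (((continuous_tensorPower w).mul (continuous_tensorPower w').star).mul continuous_const)
  have h1 : ∀ φ, wordPoly u φ * star (wordPoly v φ) =
      ∑ w, ∑ w', tensorPower m φ w * star (tensorPower m φ w') * (u w * star (v w')) := by
    intro φ
    rw [wordPoly, wordPoly, star_sum, Finset.sum_mul_sum]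
    refine Finset.sum_congr rfl fun w _ => Finset.sum_congr rfl fun w' _ => ?_
    rw [star_mul']
    ring
  simp only [h1]
  rw [integral_finsetSum _ fun w _ => integrable_finsetSum _ fun w' _ => hint w w', Finset.mul_sum]
  refine Finset.sum_congr rfl fun w _ => ?_
  rw [integral_finsetSum _ fun w' _ => hint w w']
  simp only [integral_mul_const, hμ m]
  have h2 : ∑ w' : Fin m → Fin (e + 1),
      (Fintype.card {π : Equiv.Perm (Fin m) // w ∘ π = w'} : ℂ) * star (v w') =
      m.factorial * star (v w) := by
    have h3 : ∀ w' : Fin m → Fin (e + 1),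
        (Fintype.card {π : Equiv.Perm (Fin m) // w ∘ π = w'} : ℂ) * star (v w') =
        ∑ π : Equiv.Perm (Fin m), if w ∘ π = w' then star (v w) else 0 := by
      intro w'
      rw [← Finset.sum_filter, Fintype.card_subtype, ← nsmul_eq_mul, ← Finset.sum_const]
      refine Finset.sum_congr rfl fun π hπ => ?_
      rw [← (Finset.mem_filter.1 hπ).2, hv]
    simp only [h3]
    rw [Finset.sum_comm]
    simp [Fintype.card_perm]
  have h4 : (m.factorial : ℂ) * (e.factorial / (m + e).factorial) = ((m + e).choose e : ℂ)⁻¹ := by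
    rw [Nat.cast_choose ℂ (Nat.le_add_left e m), Nat.add_sub_cancel, inv_div]
    ring
  rw [← h4]
  calc _ = (∑ w' : Fin m → Fin (e + 1),
        (Fintype.card {π : Equiv.Perm (Fin m) // w ∘ π = w'} : ℂ) * star (v w')) *
          (u w * (e.factorial / (m + e).factorial)) := by
        rw [Finset.sum_mul]
        exact Finset.sum_congr rfl fun w' _ => by ring
    _ = _ := by
        rw [h2]
        ring

theorem integral_norm_sq_wordPoly {e m : ℕ} {μ : Measure (UnitVector (e + 1))}
    [IsProbabilityMeasure μ] (hμ : HasUniformMoments μ) (v : (Fin m → Fin (e + 1)) → ℂ)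
    (hv : IsSymmTensor v) :
    ∫ φ, ‖wordPoly v φ‖ ^ 2 ∂μ = ((m + e).choose e : ℝ)⁻¹ * ∑ w, ‖v w‖ ^ 2 := by
  have h := integral_wordPoly_mul_star hμ v v hv
  simp only [Complex.star_def, Complex.mul_conj', ← Complex.ofReal_pow] at h
  rw [integral_complex_ofReal] at h
  apply Complex.ofReal_injective
  rw [h]
  push_cast
  rfl

/-- Splitting a word of length `n` into a word of length `k` and one of length `n - k`. -/
def joinEquiv (d : ℕ) {n k : ℕ} (hk : k ≤ n) :
    (Fin k → Fin d) × (Fin (n - k) → Fin d) ≃ (Fin n → Fin d) :=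
  (Fin.appendEquiv k (n - k)).trans
    ((finCongr (Nat.add_sub_of_le hk)).arrowCongr (Equiv.refl _))

theorem sum_joinWord {d n k : ℕ} {M : Type*} [AddCommMonoid M] (hk : k ≤ n)
    (F : (Fin n → Fin d) → M) : ∑ w, F w = ∑ x, ∑ z, F (joinWord hk x z) := by
  rw [← Fintype.sum_prod_type', ← (joinEquiv d hk).sum_comp]
  rfl

theorem tensorPower_joinWord {d n k : ℕ} (hk : k ≤ n) (φ : UnitVector d)
    (x : Fin k → Fin d) (z : Fin (n - k) → Fin d) :
    tensorPower n φ (joinWord hk x z) = tensorPower k φ x * tensorPower (n - k) φ z := by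
  unfold tensorPower joinWord
  rw [← (finCongr (Nat.add_sub_of_le hk)).prod_comp, Fin.prod_univ_add]
  simp

theorem IsSymmTensor.joinWord_comp {d n k : ℕ} (hk : k ≤ n) {ψ : (Fin n → Fin d) → ℂ}
    (hψ : IsSymmTensor ψ) (x : Fin k → Fin d) (z : Fin (n - k) → Fin d)
    (π : Equiv.Perm (Fin (n - k))) : ψ (joinWord hk x (z ∘ π)) = ψ (joinWord hk x z) := by
  let τ : Equiv.Perm (Fin n) := (finCongr (Nat.add_sub_of_le hk)).permCongr
    (finSumFinEquiv.permCongr (Equiv.sumCongr (Equiv.refl (Fin k)) π))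
  rw [← hψ τ (joinWord hk x z)]
  congr 1
  funext i
  obtain ⟨i, rfl⟩ := (finCongr (Nat.add_sub_of_le hk)).surjective i
  obtain ⟨i, rfl⟩ := finSumFinEquiv.surjective i
  rcases i with i | i <;> simp [joinWord, τ, Equiv.permCongr_apply]

/-- With `h` the contraction of `c` against ψ and `P_u` the polynomial of `u`, expand `0 ≤ ∫ |t
P_{h̄} - conj(P_c) P_ψ|²`. Orthogonality gives `N/D'` for the square of `P_{h̄}` and `N/D` for the
cross term. -/
theorem contraction_le_integral {e n k : ℕ} {μ : Measure (UnitVector (e + 1))}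
    [IsProbabilityMeasure μ] (hμ : HasUniformMoments μ) (hk : k ≤ n)
    (ψ : (Fin n → Fin (e + 1)) → ℂ) (hψ : IsSymmTensor ψ) (c : (Fin k → Fin (e + 1)) → ℂ) :
    ((n - k + e).choose e : ℝ) / (n + e).choose e *
        ∑ z, ‖∑ x, c x * star (ψ (joinWord hk x z))‖ ^ 2 ≤
      (n + e).choose e * ∫ φ, ‖wordPoly c φ‖ ^ 2 * ‖wordPoly ψ φ‖ ^ 2 ∂μ := by
  set D : ℝ := Nat.cast ((n + e).choose e)
  set D' : ℝ := Nat.cast ((n - k + e).choose e)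
  have hD : 0 < D := Nat.cast_pos.2 (Nat.choose_pos (Nat.le_add_left e n))
  have hD' : 0 < D' := Nat.cast_pos.2 (Nat.choose_pos (Nat.le_add_left e _))
  set h : (Fin (n - k) → Fin (e + 1)) → ℂ := fun z => ∑ x, c x * star (ψ (joinWord hk x z))
  have hh : IsSymmTensor h := fun π z => Finset.sum_congr rfl fun x _ => by
    rw [hψ.joinWord_comp]
  set N : ℝ := ∑ z, ‖h z‖ ^ 2
  have hH : ∫ φ, ‖wordPoly (star h) φ‖ ^ 2 ∂μ = D'⁻¹ * N := by
    rw [integral_norm_sq_wordPoly hμ _ hh.star]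
    simp [N, D']
  have hGH : ∫ φ, wordPoly c φ * wordPoly (star h) φ * star (wordPoly ψ φ) ∂μ =
      ((D⁻¹ * N : ℝ) : ℂ) := by
    -- The product of the two polynomials has coefficient tensor `c ⊗ h̄`, in general not symmetric;
    -- pairing it with ψ contracts `c` first and leaves `‖h‖²`.
    let u : (Fin n → Fin (e + 1)) → ℂ := fun w =>
      c ((joinEquiv (e + 1) hk).symm w).1 * star (h ((joinEquiv (e + 1) hk).symm w).2)
    have hu : ∀ x z, u (joinWord hk x z) = c x * star (h z) := by
      intro x z
      simp only [u]
      rw [show joinWord hk x z = joinEquiv (e + 1) hk (x, z) from rfl, Equiv.symm_apply_apply]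
    have hu' : ∀ φ, wordPoly c φ * wordPoly (star h) φ = wordPoly u φ := by
      intro φ
      rw [wordPoly, wordPoly, wordPoly, Finset.sum_mul_sum, sum_joinWord hk]
      refine Finset.sum_congr rfl fun x _ => Finset.sum_congr rfl fun z _ => ?_
      rw [hu, tensorPower_joinWord, Pi.star_apply]
      ring
    simp only [hu']
    rw [integral_wordPoly_mul_star hμ u ψ hψ, sum_joinWord hk, Finset.sum_comm]
    have h5 : ∀ z, ∑ x, u (joinWord hk x z) * star (ψ (joinWord hk x z)) =
        ((‖h z‖ ^ 2 : ℝ) : ℂ) := by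
      intro z
      rw [Complex.ofReal_pow, ← Complex.mul_conj', ← Complex.star_def, Finset.sum_mul]
      refine Finset.sum_congr rfl fun x _ => ?_
      rw [hu]
      ring
    simp only [h5, N, D]
    push_cast
    rfl
  have hGH' : ∫ φ, (wordPoly c φ * wordPoly (star h) φ * star (wordPoly ψ φ)).re ∂μ =
      D⁻¹ * N := by
    rw [← Complex.ofReal_re (D⁻¹ * N), ← hGH]
    exact integral_re (integrable_of_continuous μ (((continuous_wordPoly c).mul
      (continuous_wordPoly _)).mul (continuous_wordPoly ψ).star))
  -- The coefficient `D'/D` minimises `t² N/D' - 2t N/D`.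
  have hpt : ∀ φ, ‖((D' / D : ℝ) : ℂ) * wordPoly (star h) φ -
        star (wordPoly c φ) * wordPoly ψ φ‖ ^ 2 =
      (D' / D) ^ 2 * ‖wordPoly (star h) φ‖ ^ 2 -
        2 * (D' / D) * (wordPoly c φ * wordPoly (star h) φ * star (wordPoly ψ φ)).re +
        ‖wordPoly c φ‖ ^ 2 * ‖wordPoly ψ φ‖ ^ 2 := by
    intro φ
    simp only [Complex.sq_norm, Complex.normSq_apply, Complex.sub_re, Complex.sub_im,
      Complex.mul_re, Complex.mul_im, Complex.star_def, Complex.conj_re, Complex.conj_im,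
      Complex.ofReal_re, Complex.ofReal_im]
    ring
  have hpos : 0 ≤ ∫ φ, ‖((D' / D : ℝ) : ℂ) * wordPoly (star h) φ -
        star (wordPoly c φ) * wordPoly ψ φ‖ ^ 2 ∂μ :=
    integral_nonneg fun φ => sq_nonneg _
  simp only [hpt] at hpos
  have i1 : Integrable (fun φ => (D' / D) ^ 2 * ‖wordPoly (star h) φ‖ ^ 2) μ :=
    integrable_of_continuous μ (continuous_const.mul ((continuous_wordPoly _).norm.pow 2))
  have i2 : Integrable (fun φ => 2 * (D' / D) *
      (wordPoly c φ * wordPoly (star h) φ * star (wordPoly ψ φ)).re) μ :=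
    integrable_of_continuous μ (continuous_const.mul (Complex.continuous_re.comp
      (((continuous_wordPoly c).mul (continuous_wordPoly _)).mul (continuous_wordPoly ψ).star)))
  have i3 : Integrable (fun φ => ‖wordPoly c φ‖ ^ 2 * ‖wordPoly ψ φ‖ ^ 2) μ :=
    integrable_of_continuous μ
      (((continuous_wordPoly c).norm.pow 2).mul ((continuous_wordPoly ψ).norm.pow 2))
  have i12 : Integrable (fun φ => (D' / D) ^ 2 * ‖wordPoly (star h) φ‖ ^ 2 - 2 * (D' / D) *
      (wordPoly c φ * wordPoly (star h) φ * star (wordPoly ψ φ)).re) μ := i1.sub i2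
  rw [integral_add i12 i3, integral_sub i1 i2, integral_const_mul, integral_const_mul,
    hH, hGH'] at hpos
  have h6 : (D' / D) ^ 2 * (D'⁻¹ * N) - 2 * (D' / D) * (D⁻¹ * N) = -(D' / D * N) / D := by
    field_simp
    ring
  rw [h6] at hpos
  have h7 := mul_nonneg hD.le hpos
  rw [mul_add, mul_div_cancel₀ _ hD.ne'] at h7
  linarith

end BoseDeFinetti

/-! ### The ratio of dimensions -/

/-- Raising `e` by one multiplies the ratio of binomials by `1 - k/(n+e+1)`. As the ratio is at most
1, each step costs at most `k/n`. -/
theorem one_sub_mul_choose_le (n k e : ℕ) (hn : 0 < n) (hk : k ≤ n) :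
    (1 - (e : ℝ) * k / n) * (n + e).choose e ≤ (n - k + e).choose e := by
  induction e with
  | zero => simp
  | succ e ih =>
    have h1 := Nat.add_one_mul_choose_eq (n + e) e
    have h2 := Nat.add_one_mul_choose_eq (n - k + e) e
    have h3 : (n - k + e).choose e ≤ (n + e).choose e := Nat.choose_le_choose _ (by omega)
    have h1' : ((n : ℝ) + e + 1) * (n + e).choose e =
      (n + (e + 1)).choose (e + 1) * (e + 1) := by exact_mod_cast h1
    have h2' : ((n : ℝ) - k + e + 1) * (n - k + e).choose e =
      (n - k + (e + 1)).choose (e + 1) * (e + 1) := by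
      rw [← Nat.cast_sub hk]
      exact_mod_cast h2
    have h3' : ((n - k + e).choose e : ℝ) ≤ (n + e).choose e := by exact_mod_cast h3
    have he : (0 : ℝ) < e + 1 := by positivity
    have hn' : (0 : ℝ) < n := by exact_mod_cast hn
    have hk0 : (0 : ℝ) ≤ k := k.cast_nonneg
    have hD : (0 : ℝ) ≤ (n + e).choose e := Nat.cast_nonneg _
    refine le_of_mul_le_mul_right ?_ he
    rw [mul_assoc, ← h1', ← h2']
    push_cast
    have hA : ((n : ℝ) - k + e + 1) * (n - k + e).choose e ≥
        (n + e + 1) * ((n - k + e).choose e) - k * (n + e).choose e := by nlinarith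
    have hB := mul_le_mul_of_nonneg_left ih (show (0 : ℝ) ≤ n + e + 1 by positivity)
    have hC : (k : ℝ) * (n + e).choose e ≤ (n + e + 1) * (k / n) * (n + e).choose e := by
      apply mul_le_mul_of_nonneg_right _ hD
      rw [← mul_div_assoc, le_div_iff₀ hn']
      have : (0 : ℝ) ≤ e := e.cast_nonneg
      nlinarith
    calc _ = (n + e + 1) * ((1 - (e : ℝ) * k / n) * (n + e).choose e) -
          (n + e + 1) * (k / n) * (n + e).choose e := by ring
      _ ≤ _ := by linarith

/-! ### Trace norm, reduced states and the mixture -/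

namespace BoseDeFinetti

/-- In an eigenbasis of `R - S`, each eigenvalue is a difference of nonnegative diagonal entries of
`R` and `S`, so its modulus is at most their sum. -/
theorem traceNorm_sub_le {d k : ℕ} (R S : Op d k) (hR : R.PosSemidef) (hS : S.PosSemidef) :
    traceNorm (R - S) ≤ (1 / 2) * (R.trace.re + S.trace.re) := by
  have hA : (R - S).IsHermitian := hR.1.sub hS.1
  have h1 : CFC.abs (R - S) = hA.cfc (fun x => ‖x‖) := by
    rw [CFC.abs_eq_cfc_norm _ hA, hA.cfc_eq]
  have h2 : (CFC.abs (R - S)).trace = ∑ i, ((|hA.eigenvalues i| : ℝ) : ℂ) := by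
    rw [h1]
    simp [Matrix.IsHermitian.cfc, Unitary.conjStarAlgAut_apply, Matrix.trace_mul_cycle,
      Matrix.trace_diagonal]
  let v := fun i => (hA.eigenvectorBasis i).ofLp
  have h3 : ∀ M : Op d k, M.trace = ∑ i, star (v i) ⬝ᵥ M *ᵥ v i := by
    intro M
    let U : Op d k := hA.eigenvectorUnitary
    have hU : U * Uᴴ = 1 := Unitary.coe_mul_star_self hA.eigenvectorUnitary
    have : (Uᴴ * M * U).trace = M.trace := by
      rw [Matrix.trace_mul_cycle, hU, Matrix.one_mul]
    rw [← this]
    refine Finset.sum_congr rfl fun i _ => ?_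
    rw [Matrix.diag_apply, Matrix.mul_assoc, Matrix.mul_apply]
    rfl
  have h4 : ∀ i, (hA.eigenvalues i : ℂ) = star (v i) ⬝ᵥ R *ᵥ v i - star (v i) ⬝ᵥ S *ᵥ v i := by
    intro i
    rw [← dotProduct_sub, ← Matrix.sub_mulVec, hA.mulVec_eigenvectorBasis]
    have h5 : star (v i) ⬝ᵥ v i = 1 := by
      have := (hA.eigenvectorBasis.orthonormal).1 i
      have h6 := inner_self_eq_norm_sq_to_K (𝕜 := ℂ) (hA.eigenvectorBasis i)
      rw [this, EuclideanSpace.inner_eq_star_dotProduct, dotProduct_comm] at h6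
      simpa using h6
    change _ = star (v i) ⬝ᵥ (hA.eigenvalues i • v i)
    rw [dotProduct_smul, h5]
    simp
  rw [traceNorm, h2, h3 R, h3 S]
  simp only [Complex.re_sum, Complex.ofReal_re, ← Finset.sum_add_distrib]
  refine mul_le_mul_of_nonneg_left (Finset.sum_le_sum fun i _ => ?_) (by norm_num)
  have h5 := congrArg Complex.re (h4 i)
  rw [Complex.ofReal_re, Complex.sub_re] at h5
  have h6 := (Complex.le_def.1 (hR.dotProduct_mulVec_nonneg (v i))).1
  have h7 := (Complex.le_def.1 (hS.dotProduct_mulVec_nonneg (v i))).1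
  rw [Complex.zero_re] at h6 h7
  rw [h5, abs_le]
  constructor <;> linarith

/-- `ρ - σ = (1-p)ρ - (σ - pρ)` is a difference of two positive operators, each of trace `1 - p`. -/
theorem traceNorm_sub_le_one_sub {d k : ℕ} (ρ σ : Op d k) (p : ℝ) (hρ : ρ.PosSemidef)
    (hρ1 : ρ.trace = 1) (hσ1 : σ.trace = 1) (h : (σ - (p : ℂ) • ρ).PosSemidef) :
    traceNorm (ρ - σ) ≤ 1 - p := by
  have ht : (σ - (p : ℂ) • ρ).trace = ((1 - p : ℝ) : ℂ) := by
    simp [Matrix.trace_sub, Matrix.trace_smul, hρ1, hσ1]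
  have hp : 0 ≤ 1 - p := by
    have := h.trace_nonneg
    rw [ht] at this
    exact_mod_cast this
  have hR : (((1 - p : ℝ) : ℂ) • ρ).PosSemidef := hρ.smul (by exact_mod_cast hp)
  have := traceNorm_sub_le _ _ hR h
  rw [ht, Matrix.trace_smul, hρ1, smul_eq_mul, mul_one, Complex.ofReal_re] at this
  have h0 : ρ - σ = ((1 - p : ℝ) : ℂ) • ρ - (σ - (p : ℂ) • ρ) := by
    push_cast
    rw [sub_smul, one_smul]
    abel
  rw [h0]
  linarith

theorem star_dotProduct_mulVec_eq_sum {ι : Type*} [Fintype ι] (M : Matrix ι ι ℂ) (c : ι → ℂ) :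
    star c ⬝ᵥ M *ᵥ c = ∑ x, ∑ y, star (c x) * M x y * c y := by
  simp only [dotProduct, Matrix.mulVec, Finset.mul_sum, Pi.star_apply, mul_assoc]

theorem IsState.exists_symmetric_factor {d n : ℕ} {ξ : Op d n} (hξ : IsState ξ)
    (hBose : IsBoseSymmetric ξ) :
    ∃ B : (Fin n → Fin d) → (Fin n → Fin d) → ℂ, (∀ w w', ξ w w' = ∑ j, star (B j w) * B j w') ∧ ∀ j, IsSymmTensor (B j) := by
  obtain ⟨B, hB⟩ := CStarAlgebra.nonneg_iff_eq_star_mul_self.mp hξ.1.nonneg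
  have hB' : ∀ w w', ξ w w' = ∑ j, star (B j w) * B j w' := by
    intro w w'
    rw [hB, Matrix.mul_apply]
    rfl
  refine ⟨B, hB', fun j π w => ?_⟩
  have hleft : ∀ x y, ξ (x ∘ π) y = ξ x y := by
    intro x y
    have h := congrFun (congrFun (hBose π) x) y
    have h2 : ∀ z : Fin n → Fin d, x = z ∘ π.symm ↔ z = x ∘ π := by
      intro z
      constructor
      · rintro rfl
        funext i
        simp
      · rintro rfl
        funext i
        simp
    rw [Matrix.mul_apply] at h
    simpa [permOp, h2] using h
  have hright : ∀ x y, ξ x (y ∘ π) = ξ x y := by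
    intro x y
    rw [← hξ.1.1.apply x, hleft, hξ.1.1.apply]
  -- The squared distance between two columns of `B` is a combination of four entries of ξ, which
  -- cancel by invariance on both sides.
  have h0 : ∑ j, star (B j (w ∘ π) - B j w) * (B j (w ∘ π) - B j w) = 0 := by
    have h1 : ∑ j, star (B j (w ∘ π) - B j w) * (B j (w ∘ π) - B j w) =
        ξ (w ∘ π) (w ∘ π) - ξ (w ∘ π) w - (ξ w (w ∘ π) - ξ w w) := by
      simp only [hB', ← Finset.sum_sub_distrib]
      refine Finset.sum_congr rfl fun j _ => ?_
      rw [star_sub]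
      ring
    rw [h1, hleft, hleft, hright]
    ring
  have h2 := (Finset.sum_eq_zero_iff_of_nonneg fun i _ => star_mul_self_nonneg _).1 h0 j
    (Finset.mem_univ j)
  rcases mul_eq_zero.1 h2 with h3 | h3
  · exact sub_eq_zero.1 (star_eq_zero.1 h3)
  · exact sub_eq_zero.1 h3

theorem sum_norm_sq_tensorPower {d k : ℕ} (φ : UnitVector d) :
    ∑ x, tensorPower k φ x * star (tensorPower k φ x) = 1 := by
  have h : ∑ a, φ.1 a * star (φ.1 a) = 1 := by
    have h1 : ‖φ.1‖ = 1 := by simp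
    have h2 := EuclideanSpace.norm_sq_eq φ.1
    rw [h1] at h2
    simp only [Complex.star_def, Complex.mul_conj', ← Complex.ofReal_pow, ← Complex.ofReal_sum]
    rw [← h2]
    simp
  calc _ = ∑ x : Fin k → Fin d, ∏ i, (φ.1 (x i) * star (φ.1 (x i))) := by
        refine Finset.sum_congr rfl fun x _ => ?_
        rw [tensorPower, Finset.prod_mul_distrib, Complex.star_def, map_prod]
        rfl
    _ = 1 := by rw [← Fintype.sum_pow (fun a => φ.1 a * star (φ.1 a)), h, one_pow]

theorem partialTrace_trace {d n k : ℕ} (hk : k ≤ n) (ξ : Op d n) :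
    (partialTrace hk ξ).trace = ξ.trace := by
  simp only [Matrix.trace, Matrix.diag_apply]
  rw [sum_joinWord hk]
  rfl

theorem partialTrace_quadraticForm {d n k : ℕ} (hk : k ≤ n) {ξ : Op d n}
    {B : (Fin n → Fin d) → (Fin n → Fin d) → ℂ}
    (hB : ∀ w w', ξ w w' = ∑ j, star (B j w) * B j w') (c : (Fin k → Fin d) → ℂ) :
    star c ⬝ᵥ partialTrace hk ξ *ᵥ c =
      ((∑ j, ∑ z, ‖∑ x, star c x * star (B j (joinWord hk x z))‖ ^ 2 : ℝ) : ℂ) := by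
  rw [star_dotProduct_mulVec_eq_sum]
  have h : ∀ j z, ((‖∑ x, star c x * star (B j (joinWord hk x z))‖ ^ 2 : ℝ) : ℂ) =
      ∑ x, ∑ y, star (c x) * (star (B j (joinWord hk x z)) * B j (joinWord hk y z)) * c y := by
    intro j z
    rw [Complex.ofReal_pow, ← Complex.mul_conj', ← Complex.star_def, star_sum,
      Finset.sum_mul_sum]
    refine Finset.sum_congr rfl fun x _ => Finset.sum_congr rfl fun y _ => ?_
    rw [star_mul', star_star, Pi.star_apply, Pi.star_apply, star_star]
    ring
  simp only [Complex.ofReal_sum, h, partialTrace, Matrix.of_apply, hB, Finset.mul_sum,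
    Finset.sum_mul]
  simp only [Finset.sum_comm (s := (Finset.univ : Finset (Fin k → Fin d)))
    (t := (Finset.univ : Finset (Fin n → Fin d))),
    Finset.sum_comm (s := (Finset.univ : Finset (Fin k → Fin d)))
    (t := (Finset.univ : Finset (Fin (n - k) → Fin d)))]
  rw [Finset.sum_comm]

theorem partialTrace_posSemidef {d n k : ℕ} (hk : k ≤ n) {ξ : Op d n} (hξ : ξ.PosSemidef) :
    (partialTrace hk ξ).PosSemidef := by
  have : partialTrace hk ξ = ∑ z, ξ.submatrix (joinWord hk · z) (joinWord hk · z) := by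
    ext x y
    simp [partialTrace, Matrix.sum_apply]
  rw [this]
  exact Matrix.posSemidef_sum _ fun z _ => hξ.submatrix _

theorem mixture_trace {d k : ℕ} (m : Measure (UnitVector d)) [IsProbabilityMeasure m] :
    (Matrix.of fun x y => ∫ φ, pureProduct k φ x y ∂m : Op d k).trace = 1 := by
  simp only [Matrix.trace, Matrix.diag_apply, Matrix.of_apply]
  rw [← integral_finsetSum]
  · have h : ∀ φ : UnitVector d, ∑ x, pureProduct k φ x x = 1 := fun φ =>
      sum_norm_sq_tensorPower φ
    simp [h]
  · exact fun x _ => integrable_of_continuous m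
      ((continuous_tensorPower x).mul (continuous_tensorPower x).star)

theorem mixture_isHermitian {d k : ℕ} (m : Measure (UnitVector d)) :
    (Matrix.of fun x y => ∫ φ, pureProduct k φ x y ∂m : Op d k).IsHermitian := by
  ext x y
  rw [Matrix.conjTranspose_apply, Matrix.of_apply, Matrix.of_apply, Complex.star_def,
    ← integral_conj]
  refine integral_congr_ae (Filter.Eventually.of_forall fun φ => ?_)
  simp [pureProduct, Matrix.vecMulVec_apply, mul_comm]

theorem mixture_quadraticForm {d k : ℕ} (m : Measure (UnitVector d)) [IsProbabilityMeasure m]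
    (c : (Fin k → Fin d) → ℂ) :
    star c ⬝ᵥ (Matrix.of fun x y => ∫ φ, pureProduct k φ x y ∂m : Op d k) *ᵥ c =
      ((∫ φ, ‖wordPoly (star c) φ‖ ^ 2 ∂m : ℝ) : ℂ) := by
  have hint : ∀ x y : Fin k → Fin d, Integrable
      (fun φ => star (c x) * pureProduct k φ x y * c y) m := fun x y =>
    integrable_of_continuous m ((continuous_const.mul
      ((continuous_tensorPower x).mul (continuous_tensorPower y).star)).mul continuous_const)
  rw [star_dotProduct_mulVec_eq_sum, ← integral_complex_ofReal]
  have h : ∀ φ, ((‖wordPoly (star c) φ‖ ^ 2 : ℝ) : ℂ) =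
      ∑ x, ∑ y, star (c x) * pureProduct k φ x y * c y := by
    intro φ
    rw [Complex.ofReal_pow, ← Complex.mul_conj', ← Complex.star_def, wordPoly, star_sum,
      Finset.sum_mul_sum]
    refine Finset.sum_congr rfl fun x _ => Finset.sum_congr rfl fun y _ => ?_
    rw [star_mul', Pi.star_apply, Pi.star_apply, star_star, pureProduct, Matrix.vecMulVec_apply,
      Pi.star_apply]
    ring
  simp only [h]
  rw [integral_finsetSum _ fun x _ => integrable_finsetSum _ fun y _ => hint x y]
  refine Finset.sum_congr rfl fun x _ => ?_
  rw [integral_finsetSum _ fun y _ => hint x y]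
  refine Finset.sum_congr rfl fun y _ => ?_
  rw [Matrix.of_apply, integral_mul_const, integral_const_mul]

theorem exists_mixture_ge {e n k : ℕ} (hk : k ≤ n) {ξ : Op (e + 1) n} (hξ : IsState ξ)
    (hBose : IsBoseSymmetric ξ) :
    ∃ σ ∈ pureProductMixtures (e + 1) k, σ.trace = 1 ∧
      (σ - (((n - k + e).choose e / (n + e).choose e : ℝ) : ℂ) •
        partialTrace hk ξ).PosSemidef := by
  obtain ⟨μ, hμp, hμ⟩ := exists_sphere_measure e
  replace hμ : HasUniformMoments μ := hμ
  obtain ⟨B, hB, hBs⟩ := hξ.exists_symmetric_factor hBose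
  have hD : 0 < ((n + e).choose e : ℝ) := Nat.cast_pos.2 (Nat.choose_pos (Nat.le_add_left e n))
  -- This is `D_n ⟨φ^{⊗n}|ξ|φ^{⊗n}⟩`; the factor `D_n` makes its integral equal to `tr ξ = 1`.
  let W : UnitVector (e + 1) → ℝ := fun φ =>
    (n + e).choose e * ∑ j, ‖wordPoly (B j) φ‖ ^ 2
  have hW0 : ∀ φ, 0 ≤ W φ := fun φ =>
    mul_nonneg hD.le (Finset.sum_nonneg fun j _ => sq_nonneg _)
  have hWc : Continuous W := continuous_const.mul
    (continuous_finsetSum _ fun j _ => (continuous_wordPoly _).norm.pow 2)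
  have hW1 : ∫ φ, W φ ∂μ = 1 := by
    simp only [W]
    rw [integral_const_mul, integral_finsetSum]
    swap
    · exact fun j _ => integrable_of_continuous μ ((continuous_wordPoly (B j)).norm.pow 2)
    simp only [integral_norm_sq_wordPoly hμ _ (hBs _)]
    rw [← Finset.mul_sum, mul_inv_cancel_left₀ hD.ne', Finset.sum_comm]
    have h := hξ.2
    simp only [Matrix.trace, Matrix.diag_apply, hB, Complex.star_def, Complex.conj_mul'] at h
    exact_mod_cast h
  let m : Measure (UnitVector (e + 1)) := μ.withDensity fun φ => ENNReal.ofReal (W φ)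
  have hm : IsProbabilityMeasure m := by
    refine ⟨?_⟩
    rw [withDensity_apply _ MeasurableSet.univ, Measure.restrict_univ,
      ← ofReal_integral_eq_lintegral_ofReal (integrable_of_continuous μ hWc)
        (Filter.Eventually.of_forall hW0), hW1, ENNReal.ofReal_one]
  have hmint : ∀ g : UnitVector (e + 1) → ℝ, ∫ φ, g φ ∂m = ∫ φ, W φ * g φ ∂μ := by
    intro g
    rw [integral_withDensity_eq_integral_toReal_smul hWc.measurable.ennreal_ofReal
      (Filter.Eventually.of_forall fun _ => ENNReal.ofReal_lt_top)]
    simp only [ENNReal.toReal_ofReal (hW0 _), smul_eq_mul]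
  refine ⟨_, ⟨m, hm, rfl⟩, mixture_trace m, .of_dotProduct_mulVec_nonneg ?_ fun c => ?_⟩
  · refine (mixture_isHermitian m).sub ?_
    have := (partialTrace_posSemidef hk hξ.1).1
    rw [Matrix.IsHermitian, Matrix.conjTranspose_smul, this, Complex.star_def,
      Complex.conj_ofReal]
  · rw [Matrix.sub_mulVec, dotProduct_sub, Matrix.smul_mulVec, dotProduct_smul,
      mixture_quadraticForm, partialTrace_quadraticForm hk hB, smul_eq_mul, ← Complex.ofReal_mul,
      ← Complex.ofReal_sub, Complex.zero_le_real, sub_nonneg, hmint, Finset.mul_sum]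
    have h1 : ∀ φ, W φ * ‖wordPoly (star c) φ‖ ^ 2 =
        ∑ j, (n + e).choose e * (‖wordPoly (star c) φ‖ ^ 2 * ‖wordPoly (B j) φ‖ ^ 2) := by
      intro φ
      simp only [W]
      rw [Finset.mul_sum, Finset.sum_mul]
      exact Finset.sum_congr rfl fun j _ => by ring
    simp only [h1]
    rw [integral_finsetSum]
    swap
    · exact fun j _ => integrable_of_continuous μ (continuous_const.mul
        (((continuous_wordPoly _).norm.pow 2).mul ((continuous_wordPoly _).norm.pow 2)))
    refine Finset.sum_le_sum fun j _ => ?_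
    rw [integral_const_mul]
    exact contraction_le_integral hμ hk (B j) (hBs j) (star c)

end BoseDeFinetti

end

theorem mainTheorem4 (d n k : ℕ) (hn : 0 < n) (hk : k ≤ n)
    (ξ : BoseDeFinetti.Op d n) (hξ : BoseDeFinetti.IsState ξ)
    (hBose : BoseDeFinetti.IsBoseSymmetric ξ) :
    BoseDeFinetti.IsCloseTo (2 * ((d : ℝ) * (k : ℝ) / (n : ℝ)))
      (BoseDeFinetti.partialTrace hk ξ) (BoseDeFinetti.pureProductMixtures d k) := by
  obtain _ | e := d
  -- For `d = 0` there are no words of positive length, so no operator has trace one.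
  · have : IsEmpty (Fin n → Fin 0) := ⟨fun w => (w ⟨0, hn⟩).elim0⟩
    have h := hξ.2
    simp [Matrix.trace] at h
  obtain ⟨σ, hσ, hσ1, hpos⟩ := BoseDeFinetti.exists_mixture_ge hk hξ hBose
  refine ⟨σ, hσ, (BoseDeFinetti.traceNorm_sub_le_one_sub _ σ _
    (BoseDeFinetti.partialTrace_posSemidef hk hξ.1)
    ((BoseDeFinetti.partialTrace_trace hk ξ).trans hξ.2) hσ1 hpos).trans ?_⟩
  have hD : 0 < ((n + e).choose e : ℝ) := Nat.cast_pos.2 (Nat.choose_pos (Nat.le_add_left e n))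
  -- This yields the sharper bound `(d-1)k/n`; the rest only weakens it.
  have h := (le_div_iff₀ hD).2 (one_sub_mul_choose_le n k e hn hk)
  have h2 : (0 : ℝ) ≤ e * k / n := by positivity
  have h3 : (0 : ℝ) ≤ k / n := by positivity
  push_cast
  rw [add_mul, add_div, one_mul]
  linarith
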